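/- Let $d\ge 0$, let $f:\mathbb{R}^d\to\mathbb{R}^d$ be a $C^\infty$ function, let $t_0\in\mathbb{R}$, $x_0\in\mathbb{R}^d$, and consider the autonomous ODE problem $\dot x(t)=f(x(t))$, $t\in(t_0,T]$, $x(t_0)=x_0$, where a solution is a function continuous on $[t_0,T]$, with one-sided derivative at $T$. For a rooted tree $\tau$ with $|\tau|$ vertices, the elementary differential $F(\tau):\mathbb{R}^d\to\mathbb{R}^d$ is defined recursively by $F(\emptyset)=\mathrm{Id}$, $F(\bullet)=f$ for the single-vertex tree $\bullet$, and $F(\tau)=\nabla^m f\,(F(\tau_1),\dots,F(\tau_m))$ if $\tau=[\tau_1,\dots,\tau_m]$ is obtained by joining the roots of nonempty trees $\tau_1,\dots,\tau_m$ to a new root. For a labelled tree, $F$ is evaluated on the underlying unlabelled rooted tree. Let $(p_n)_{n\ge 0}$ be a probability distribution on $\mathbb{N}$ with $p_n>0$ for all $n\geq 0$. Let $\mathcal{T}$ be a random labelled tree generated by uniform attachment: its number of vertices $|\mathcal T|$ is chosen with $\mathbb{P}(|\mathcal{T}|=n)=p_n$ ($\mathcal T$ is the empty tree if $n=0$); given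 $|\mathcal T|=n\ge 1$, one starts from a root with label $1$ and, for $l=1,\dots,n-1$ successively, attaches a new vertex with label $l+1$ to a vertex chosen uniformly, and independently of the past, among the $l$ vertices present. Assume that there is $C>0$ such that $|\nabla^m f(x_0)|\le C$ for all $m\ge 0$, where $|\cdot|$ is the operator norm of multilinear maps with respect to the Euclidean norm. Then: 1. For every $t\in[t_0,t_0+1/C)$ the random variable $$\frac{(t-t_0)^{|\mathcal{T}|}F(\mathcal{T})(x_0)}{(|\mathcal{T}|\vee 1)\,p_{|\mathcal{T}|}}$$ is integrable. 2. If $T>t_0$ and $x$ is a solution of the ODE problem on $[t_0,T]$ which is real-analytic on $[t_0,T]$, then $$x(t)=\mathbb{E}\left[\frac{(t-t_0)^{|\mathcal{T}|}F(\mathcal{T})(x_0)}{(|\mathcal{T}|\vee 1)\,p_{|\mathcal{T}|}}\right]\qquad\text{for all } t\in[t_0,T]\text{ with } t<t_0+1/C.$$ 3. If $f$ is real-analytic on $\mathbb{R}^d$, then the ODE problem has a solution on $[t_0,t_0+1/C)$, and for every $T>t_0$ every solution $x$ on $[t_0,T]$ satisfies the identity in 2. for all $t\in[t_0,T]$ with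 $t<t_0+1/C$. -/

import Mathlib

open MeasureTheory ProbabilityTheory
open scoped ContDiff

namespace Butcher

noncomputable section

/-! ### Rooted trees -/

/-- Nonempty rooted trees with ordered branches: `node m c` is the tree `[c 0, …, c (m - 1)]`
(the `B⁺` operation); `node 0 _` is the single-vertex tree. -/
inductive OrderedTree : Type
  | node (m : ℕ) (branch : Fin m → OrderedTree) : OrderedTree

/-- Two ordered trees represent the same rooted tree when they differ by a reordering of the
branches at each vertex. -/
inductive OrderedTree.Iso : OrderedTree → OrderedTree → Prop
  | node {m : ℕ} (c c' : Fin m → OrderedTree) (e : Equiv.Perm (Fin m))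
      (h : ∀ i, OrderedTree.Iso (c i) (c' (e i))) :
      OrderedTree.Iso (OrderedTree.node m c) (OrderedTree.node m c')

/-- The set of rooted trees: the empty tree `none`, and the nonempty (unordered) rooted trees. -/
abbrev RootedTree : Type := Option (Quot OrderedTree.Iso)

/-! ### Elementary differentials -/

section ElementaryDifferential

variable {E : Type*} [NormedAddCommGroup E] [NormedSpace ℝ E]

/-- The iterated derivatives of a smooth function are symmetric. -/
theorem iteratedFDeriv_comp_perm_of_smooth {f : E → E} (hf : ContDiff ℝ ∞ f) (m : ℕ)
    (σ : Equiv.Perm (Fin m)) (x : E) (v : Fin m → E) :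
    iteratedFDeriv ℝ m f x (v ∘ σ) = iteratedFDeriv ℝ m f x v := by
  have hdiff : ∀ k : ℕ, Differentiable ℝ (iteratedFDeriv ℝ k f) := fun k =>
    hf.differentiable_iteratedFDeriv (by exact_mod_cast WithTop.coe_lt_top _)
  have hstep : ∀ (k : ℕ) (x : E) (w : Fin (k + 1) → E), iteratedFDeriv ℝ (k + 1) f x w
      = fderiv ℝ (fun y => iteratedFDeriv ℝ k f y (Fin.tail w)) x (w 0) := fun k x w =>
    (hdiff k x).iteratedFDeriv_succ_apply_left'
  induction m generalizing x with
  | zero => exact congrArg _ (Subsingleton.elim _ _)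
  | succ m ih =>
    have hσ : σ ∈ Submonoid.closure
        (Set.range fun i : Fin m => Equiv.swap i.castSucc i.succ) := by
      rw [Equiv.Perm.mclosure_swap_castSucc_succ]; trivial
    induction hσ using Submonoid.closure_induction generalizing v with
    | one => rfl
    | mul a b _ _ ha hb =>
      have h : v ∘ ⇑(a * b) = (v ∘ a) ∘ b := rfl
      rw [h, hb, ha]
    | mem s hs =>
      obtain ⟨i, rfl⟩ := hs
      cases m with
      | zero => exact i.elim0
      | succ k =>
        induction i using Fin.cases with
        | zero =>
          have hsm : ∀ u, ContDiff ℝ ∞ fun y => iteratedFDeriv ℝ k f y u := fun u => by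
            have h1 : ContDiff ℝ ∞ (iteratedFDeriv ℝ k f) :=
              hf.iteratedFDeriv_right (by exact_mod_cast le_top)
            exact (ContinuousMultilinearMap.apply ℝ (fun _ : Fin k => E) E u).contDiff.comp h1
          have h2 : ∀ w : Fin (k + 2) → E, iteratedFDeriv ℝ (k + 2) f x w
              = fderiv ℝ (fderiv ℝ (fun y => iteratedFDeriv ℝ k f y (Fin.tail (Fin.tail w)))) x
                (w 0) (w 1) := fun w => by
            rw [hstep]
            simp only [hstep]
            have h3 : DifferentiableAt ℝ
                (fderiv ℝ fun y => iteratedFDeriv ℝ k f y (Fin.tail (Fin.tail w))) x :=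
              ((hsm _).fderiv_right (m := ∞) (by norm_cast)).differentiable
                (by simp) x
            rw [fderiv_clm_apply h3 (by fun_prop)]
            simp [Fin.tail]
          rw [h2, h2]
          have h4 : Fin.tail (Fin.tail (v ∘ Equiv.swap (Fin.castSucc 0) (Fin.succ 0)))
              = Fin.tail (Fin.tail v) := by
            funext j
            simp only [Fin.tail, Function.comp]
            rw [Equiv.swap_apply_of_ne_of_ne]
            · simp [Fin.ext_iff]
            · simp [Fin.ext_iff]
          have h5 := ((hsm (Fin.tail (Fin.tail v))).contDiffAt (x := x)).isSymmSndFDerivAt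
            (by
              rw [minSmoothness_of_isRCLikeNormedField]
              exact WithTop.coe_le_coe.2 (le_top : (2 : ℕ∞) ≤ ⊤))
          rw [h4, h5.eq]
          simp
        | succ j =>
          have h1 : Fin.tail (v ∘ Equiv.swap j.succ.castSucc j.succ.succ)
              = Fin.tail v ∘ Equiv.swap j.castSucc j.succ := by
            funext l
            simp only [Fin.tail, Function.comp]
            congr 1
            rw [← Fin.succ_castSucc]
            exact ((Fin.succ_injective _).map_swap ..).symm
          have h2 : (v ∘ Equiv.swap j.succ.castSucc j.succ.succ) 0 = v 0 := by
            simp only [Function.comp]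
            rw [Equiv.swap_apply_of_ne_of_ne] <;> simp [Fin.ext_iff]
          rw [hstep, hstep, h1, h2]
          simp only [ih]

/-- The elementary differential of an ordered tree:
`F [τ₁, …, τₘ] = ∇ᵐ f (F τ₁, …, F τₘ)`; for `m = 0` this is `f`. -/
def OrderedTree.elementaryDifferential (f : E → E) : OrderedTree → E → E
  | .node m c => fun x =>
      iteratedFDeriv ℝ m f x fun i => OrderedTree.elementaryDifferential f (c i) x

/-- By symmetry of the derivatives of a smooth function, the elementary differential does not
depend on the order of the branches. -/
theorem OrderedTree.elementaryDifferential_eq_of_iso {f : E → E} (hf : ContDiff ℝ ∞ f)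
    {τ τ' : OrderedTree} (h : OrderedTree.Iso τ τ') :
    τ.elementaryDifferential f = τ'.elementaryDifferential f := by
  induction h with
  | @node m c c' e h ih =>
    funext x
    simp only [OrderedTree.elementaryDifferential]
    have h1 : (fun i => (c i).elementaryDifferential f x)
        = (fun i => (c' i).elementaryDifferential f x) ∘ e := by
      funext i
      simp [ih i]
    rw [h1]
    exact iteratedFDeriv_comp_perm_of_smooth hf m e x _

/-- The elementary differential `F τ` of a smooth vector field `f`, for a rooted tree `τ`;
`F ∅ = Id`. -/
def elementaryDifferential (f : E → E) (hf : ContDiff ℝ ∞ f) : RootedTree → E → E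
  | none => id
  | some τ => Quot.lift (fun σ => OrderedTree.elementaryDifferential f σ)
      (fun _ _ h => OrderedTree.elementaryDifferential_eq_of_iso hf h) τ

end ElementaryDifferential

/-! ### Labelled trees -/

/-- Rooted trees of order `n` with vertex set `{0, …, n - 1}` in which the label of every vertex
is smaller than that of each of its children. The edges are the pairs `(parent v, v)`; the root
is the vertex `0` (the label `1` if one counts labels from `1`). For `n = 0` this is the empty
tree. -/
@[ext]
structure LabelledTree (n : ℕ) : Type where
  /-- The parent of a vertex; only the root has none. -/
  parent : Fin n → Option (Fin n)
  parent_eq_none_iff : ∀ v, parent v = none ↔ v.val = 0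
  lt_of_parent_eq : ∀ v w, parent w = some v → v < w

namespace LabelledTree

/-- The empty tree. -/
def empty : LabelledTree 0 where
  parent v := v.elim0
  parent_eq_none_iff v := v.elim0
  lt_of_parent_eq v := v.elim0

/-- The single-vertex tree. -/
def single : LabelledTree 1 where
  parent _ := none
  parent_eq_none_iff v := by simp
  lt_of_parent_eq v w h := by simp at h

/-- Attach a new vertex, with the next label, to the vertex `l` of `τ`. -/
def attach {n : ℕ} (τ : LabelledTree n) (l : Fin n) : LabelledTree (n + 1) where
  parent := Fin.lastCases (some l.castSucc) fun v => (τ.parent v).map Fin.castSucc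
  parent_eq_none_iff v := by
    induction v using Fin.lastCases with
    | last =>
      have := l.pos
      simp only [Fin.lastCases_last, Fin.val_last]
      constructor
      · intro h; cases h
      · intro h; omega
    | cast v => simp [τ.parent_eq_none_iff]
  lt_of_parent_eq v w h := by
    induction w using Fin.lastCases with
    | last =>
      simp only [Fin.lastCases_last, Option.some.injEq] at h
      exact h ▸ Fin.castSucc_lt_last l
    | cast w =>
      simp only [Fin.lastCases_castSucc, Option.map_eq_some_iff] at h
      obtain ⟨u, hu, rfl⟩ := h
      exact Fin.castSucc_lt_castSucc_iff.2 (τ.lt_of_parent_eq u w hu)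

/-- The children of a vertex. -/
def children {n : ℕ} (τ : LabelledTree n) (v : Fin n) : Finset (Fin n) :=
  Finset.univ.filter fun w => τ.parent w = some v

/-- The tree of all descendants of `v`, without its labels. The branches are listed by increasing
label; this choice disappears in `LabelledTree.forget`. -/
def descendants {n : ℕ} (τ : LabelledTree n) (v : Fin n) : OrderedTree :=
  .node (τ.children v).card fun i =>
    τ.descendants ((τ.children v).orderEmbOfFin rfl i)
termination_by n - v.val
decreasing_by
  have h1 := Finset.orderEmbOfFin_mem (τ.children v) rfl i
  have h2 := τ.lt_of_parent_eq _ _ (Finset.mem_filter.1 h1).2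
  simp only [Fin.lt_def] at h2
  omega

/-- The forgetful map from labelled trees to rooted trees. -/
def forget : {n : ℕ} → LabelledTree n → RootedTree
  | 0, _ => none
  | _ + 1, τ => some (Quot.mk _ (τ.descendants 0))

end LabelledTree

/-! ### Random trees -/

/-- Labelled trees of arbitrary order, as a discrete measurable space; `τ.1` is the order. -/
def AnyLabelledTree : Type := Σ n : ℕ, LabelledTree n

instance : MeasurableSpace AnyLabelledTree := ⊤

/-- The order (number of vertices) of a labelled tree. -/
def AnyLabelledTree.order (τ : AnyLabelledTree) : ℕ := τ.1

/-- The rooted tree underlying a labelled tree. -/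
def AnyLabelledTree.forget (τ : AnyLabelledTree) : RootedTree := τ.2.forget

/-- The law of the labelled tree of order `n` grown from the root by attaching each new vertex to
a uniformly chosen vertex of the current tree, independently of the past. -/
def uniformAttachment : (n : ℕ) → PMF (LabelledTree n)
  | 0 => PMF.pure LabelledTree.empty
  | 1 => PMF.pure LabelledTree.single
  | n + 2 => (uniformAttachment (n + 1)).bind fun τ =>
      (PMF.uniformOfFintype (Fin (n + 1))).map τ.attach

/-- The law of the random labelled tree: choose the order with distribution `p`, then grow a tree
of that order by uniform attachment. -/
def randomTree (p : PMF ℕ) : PMF AnyLabelledTree :=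
  p.bind fun n => (uniformAttachment n).map fun τ => ⟨n, τ⟩

/-! ### The differential equation and its random tree functional -/

/-- `x` solves `x' = f(x)` on `(t₀, T]` with `x(t₀) = x₀`, and is continuous on `[t₀, T]`;
the derivative at `T` is one-sided. Only the values of `x` on `[t₀, T]` matter. -/
structure IsSolution {E : Type*} [NormedAddCommGroup E] [NormedSpace ℝ E]
    (f : E → E) (t₀ T : ℝ) (x₀ : E) (x : ℝ → E) : Prop where
  continuousOn : ContinuousOn x (Set.Icc t₀ T)
  initial : x t₀ = x₀
  hasDeriv : ∀ t ∈ Set.Ioc t₀ T, HasDerivWithinAt x (f (x t)) (Set.Icc t₀ T) t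

/-- `(t - t₀)^|τ| F(τ)(x₀) / ((|τ| ∨ 1) p_|τ|)`. -/
def treeFunctional {E : Type*} [NormedAddCommGroup E] [NormedSpace ℝ E]
    (f : E → E) (hf : ContDiff ℝ ∞ f) (p : PMF ℕ) (t₀ : ℝ) (x₀ : E) (t : ℝ)
    (τ : AnyLabelledTree) : E :=
  ((t - t₀) ^ τ.order / (((max τ.order 1 : ℕ) : ℝ) * (p τ.order).toReal)) •
    elementaryDifferential f hf τ.forget x₀

end

end Butcher

/-! Conditioning on the order turns the expectation into a power series. Write `D n` for
`flowDerivative f n`, so that the `n`-th derivative of a solution `x` is `D n (x t)`. By the product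
rule and the symmetry of the derivatives of `f`, differentiating `F τ` along `f` gives the sum of
`F` over all ways of attaching one leaf to `τ` (`fderiv_elementaryDifferential_descendants`).
Uniform attachment to a tree with `n` vertices takes this sum divided by `n`; by induction the mean
of `F` over trees of order `n ≥ 1` is `D n / (n - 1)!`. The weight `1 / (|τ| ∨ 1)` makes it `D n /
n!`, the probability `p n` cancels, and the expectation is the formal Taylor series `S t = ∑ (t -
t₀) ^ n D n x₀ / n!` of a solution.

Each vertex contributes at most a factor `C` to `F τ x₀`. A geometric series then gives
integrability, and `S` converges on radius `1 / C` whether or not `f` is analytic.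

It remains to compare `S` with solutions having the same derivatives at `t₀`. If `x` is analytic,
the identity theorem gives `x = S`. If `f` is analytic, comparison with a local Picard–Lindelöf
solution shows that `S' - f(S)` vanishes to infinite order at `t₀`; being analytic, it vanishes
identically. So `S` is a solution, and uniqueness identifies every solution with it. -/

namespace Butcher

/-! ### Calculus of `x ↦ ∇ᵐ f (g₁ x, …, gₘ x)`. -/

section SmoothVectorField

variable {E : Type*} [NormedAddCommGroup E] [NormedSpace ℝ E]

/-- Evaluation is jointly multilinear in the map and its `m` arguments. `A` encodes this with one
slot for the map and one per argument, each slot reading its own component of the same pair. -/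
theorem _root_.ContDiff.continuousMultilinearMap_apply_apply {G : Type*} [NormedAddCommGroup G]
    [NormedSpace ℝ G] {n : WithTop ℕ∞} {m : ℕ}
    {L : G → ContinuousMultilinearMap ℝ (fun _ : Fin m => E) E}
    {g : Fin m → G → E} (hL : ContDiff ℝ n L) (hg : ∀ i, ContDiff ℝ n (g i)) :
    ContDiff ℝ n fun x => L x fun i => g i x := by
  let A := ContinuousLinearMap.continuousMultilinearMapOption
    (ContinuousLinearMap.id ℝ (ContinuousMultilinearMap ℝ (fun _ : Fin m => E) E))
  have h : ContDiff ℝ n fun x => A fun _ => (L x, fun i => g i x) :=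
    A.contDiff.comp (contDiff_pi.2 fun _ => hL.prodMk (contDiff_pi.2 hg))
  exact h

theorem contDiff_iteratedFDeriv {f : E → E} (hf : ContDiff ℝ ∞ f) (m : ℕ) :
    ContDiff ℝ ∞ (iteratedFDeriv ℝ m f) :=
  hf.iteratedFDeriv_right (by exact_mod_cast le_top)

theorem OrderedTree.contDiff_elementaryDifferential {f : E → E} (hf : ContDiff ℝ ∞ f)
    (τ : OrderedTree) : ContDiff ℝ ∞ (τ.elementaryDifferential f) := by
  induction τ with
  | node m c ih =>
    exact (contDiff_iteratedFDeriv hf m).continuousMultilinearMap_apply_apply ih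

/-- The product rule for `x ↦ ∇ᵐ f (g₁ x, …, gₘ x)`. -/
theorem fderiv_iteratedFDeriv_apply {f : E → E} (hf : ContDiff ℝ ∞ f) {m : ℕ}
    {g : Fin m → E → E} (hg : ∀ i, Differentiable ℝ (g i)) (x u : E) :
    fderiv ℝ (fun y => iteratedFDeriv ℝ m f y fun i => g i y) x u
      = iteratedFDeriv ℝ (m + 1) f x (Fin.cons u fun i => g i x)
        + ∑ i, iteratedFDeriv ℝ m f x
            (Function.update (fun i => g i x) i (fderiv ℝ (g i) x u)) := by
  have hd : Differentiable ℝ (iteratedFDeriv ℝ m f) :=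
    (contDiff_iteratedFDeriv hf m).differentiable (by simp)
  have h := (hd x).hasFDerivAt.continuousMultilinearMap_apply fun i => (hg i x).hasFDerivAt
  rw [h.fderiv, iteratedFDeriv_succ_apply_left]
  simp

/-- Two injective enumerations of one set differ by a permutation. This frees later arguments from
listing branches by increasing label. -/
theorem iteratedFDeriv_comp_eq_of_range_eq {f : E → E} (hf : ContDiff ℝ ∞ f) {ι : Type*} {m : ℕ}
    {e e' : Fin m → ι} (he : Function.Injective e) (he' : Function.Injective e')
    (h : Set.range e = Set.range e') (x : E) (g : ι → E) :
    iteratedFDeriv ℝ m f x (fun i => g (e i)) = iteratedFDeriv ℝ m f x fun i => g (e' i) := by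
  let σ : Equiv.Perm (Fin m) :=
    ((Equiv.ofInjective e he).trans (Equiv.setCongr h)).trans (Equiv.ofInjective e' he').symm
  have hσ : ∀ i, e' (σ i) = e i := fun i =>
    congrArg Subtype.val ((Equiv.ofInjective e' he').apply_symm_apply
      (Equiv.setCongr h (Equiv.ofInjective e he i)))
  rw [← iteratedFDeriv_comp_perm_of_smooth hf m σ x fun i => g (e' i)]
  congr 1
  funext i
  simp [hσ]

end SmoothVectorField

/-! ### Subtrees of labelled trees and attachment of a leaf. -/

namespace LabelledTree

variable {n : ℕ} (τ : LabelledTree n)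

theorem mem_children {v w : Fin n} : w ∈ τ.children v ↔ τ.parent w = some v := by
  simp [children]

theorem lt_of_mem_children {v w : Fin n} (h : w ∈ τ.children v) : v < w :=
  τ.lt_of_parent_eq v w (τ.mem_children.1 h)

/-- Labels increase from parent to child and are bounded by `n`, so recursion towards the leaves
terminates. -/
theorem children_induction {P : Fin n → Prop} (h : ∀ v, (∀ w ∈ τ.children v, P w) → P v)
    (v : Fin n) : P v :=
  h v fun w _ => children_induction h w
termination_by n - v.val
decreasing_by
  have := τ.lt_of_mem_children ‹_›
  simp only [Fin.lt_def] at this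
  omega

/-- The vertices of the subtree above `v`, including `v`. -/
noncomputable def subtree (v : Fin n) : Finset (Fin n) := by
  classical
  exact Finset.univ.filter (Relation.ReflTransGen (fun a b => τ.parent b = some a) v)

theorem mem_subtree {v l : Fin n} :
    l ∈ τ.subtree v ↔ Relation.ReflTransGen (fun a b => τ.parent b = some a) v l := by
  simp [subtree]

theorem self_mem_subtree (v : Fin n) : v ∈ τ.subtree v :=
  τ.mem_subtree.2 .refl

theorem le_of_mem_subtree {v l : Fin n} (h : l ∈ τ.subtree v) : v ≤ l := by
  rw [mem_subtree] at h
  induction h with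
  | refl => exact le_rfl
  | tail _ h ih => exact ih.trans (τ.lt_of_parent_eq _ _ h).le

theorem mem_subtree_iff {v l : Fin n} :
    l ∈ τ.subtree v ↔ l = v ∨ ∃ w ∈ τ.children v, l ∈ τ.subtree w := by
  simp only [mem_subtree, mem_children]
  rw [Relation.ReflTransGen.cases_head_iff, eq_comm]

theorem subtree_eq [DecidableEq (Fin n)] (v : Fin n) :
    τ.subtree v = insert v ((τ.children v).biUnion τ.subtree) := by
  ext l
  simp [τ.mem_subtree_iff (v := v)]

theorem notMem_subtree_of_mem_children {v w : Fin n} (h : w ∈ τ.children v) :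
    v ∉ τ.subtree w := fun h' =>
  (τ.lt_of_mem_children h).not_ge (τ.le_of_mem_subtree h')

theorem notMem_biUnion_subtree [DecidableEq (Fin n)] (v : Fin n) :
    v ∉ (τ.children v).biUnion τ.subtree := by
  simp only [Finset.mem_biUnion, not_exists, not_and]
  exact fun w hw => τ.notMem_subtree_of_mem_children hw

theorem notMem_subtree_of_siblings {v w w' : Fin n} (hw : w ∈ τ.children v)
    (hw' : w' ∈ τ.children v) (hne : w ≠ w') : w' ∉ τ.subtree w := by
  intro h
  rcases Relation.ReflTransGen.cases_tail (τ.mem_subtree.1 h) with h | ⟨b, hb, hp⟩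
  · exact hne h.symm
  · rw [τ.mem_children.1 hw', Option.some.injEq] at hp
    exact τ.notMem_subtree_of_mem_children hw (τ.mem_subtree.2 (hp ▸ hb))

/-- Parents are unique, so the ancestors of a vertex form a chain; two siblings in that chain would
be comparable, which the labels forbid. -/
theorem pairwiseDisjoint_subtree (v : Fin n) :
    (τ.children v : Set (Fin n)).PairwiseDisjoint τ.subtree := by
  intro w hw w' hw' hne
  refine Finset.disjoint_left.2 fun l hl hl' => ?_
  have hu : Relator.RightUnique (fun b a => τ.parent b = some a) := fun a b c hb hc =>
    Option.some.inj (hb.symm.trans hc)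
  have h1 := Relation.reflTransGen_swap.2 (τ.mem_subtree.1 hl)
  have h2 := Relation.reflTransGen_swap.2 (τ.mem_subtree.1 hl')
  rcases Relation.ReflTransGen.total_of_right_unique hu h1 h2 with h | h
  · exact τ.notMem_subtree_of_siblings hw' hw hne.symm
      (τ.mem_subtree.2 (Relation.reflTransGen_swap.1 h))
  · exact τ.notMem_subtree_of_siblings hw hw' hne
      (τ.mem_subtree.2 (Relation.reflTransGen_swap.1 h))

theorem subtree_root {n : ℕ} (τ : LabelledTree (n + 1)) : τ.subtree 0 = Finset.univ := by
  refine Finset.eq_univ_of_forall fun l => ?_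
  induction l using WellFoundedLT.induction with
  | ind l ih =>
    cases h : τ.parent l with
    | none =>
      rw [Fin.ext ((τ.parent_eq_none_iff l).1 h) (b := 0)]
      exact τ.self_mem_subtree 0
    | some v => exact τ.mem_subtree.2 ((τ.mem_subtree.1 (ih v (τ.lt_of_parent_eq v l h))).tail h)

theorem castSucc_mem_children_attach {l v w : Fin n} :
    w.castSucc ∈ (τ.attach l).children v.castSucc ↔ w ∈ τ.children v := by
  simp only [mem_children, attach, Fin.lastCases_castSucc, Option.map_eq_some_iff,
    Fin.castSucc_inj, exists_eq_right]

theorem last_mem_children_attach {l v : Fin n} :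
    Fin.last n ∈ (τ.attach l).children v.castSucc ↔ l = v := by
  simp [mem_children, attach]

theorem children_last {n : ℕ} (τ : LabelledTree (n + 1)) : τ.children (Fin.last n) = ∅ :=
  Finset.eq_empty_of_forall_notMem fun w hw =>
    (τ.lt_of_mem_children hw).not_ge (Fin.le_last w)

/-! ### Elementary differentials of labelled trees. -/

section

variable {E : Type*} [NormedAddCommGroup E] [NormedSpace ℝ E] {f : E → E}

/-- The elementary differential of a subtree, with the branches listed in any order. -/
theorem elementaryDifferential_descendants (hf : ContDiff ℝ ∞ f) (v : Fin n) {m : ℕ}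
    {e : Fin m → Fin n} (he : Function.Injective e) (hr : ∀ w, w ∈ τ.children v ↔ ∃ i, e i = w)
    (x : E) : (τ.descendants v).elementaryDifferential f x
      = iteratedFDeriv ℝ m f x fun i => (τ.descendants (e i)).elementaryDifferential f x := by
  have hm : m = (τ.children v).card := by
    have : τ.children v = Finset.univ.image e := by ext w; simp [hr]
    rw [this, Finset.card_image_of_injective _ he]
    simp
  subst hm
  rw [descendants, OrderedTree.elementaryDifferential]
  refine iteratedFDeriv_comp_eq_of_range_eq hf ((τ.children v).orderEmbOfFin rfl).injective he ?_ x
    fun w => (τ.descendants w).elementaryDifferential f x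
  rw [Finset.range_orderEmbOfFin]
  ext w
  simp [hr]

theorem elementaryDifferential_descendants_last {n : ℕ} (τ : LabelledTree (n + 1))
    (hf : ContDiff ℝ ∞ f) (x : E) :
    (τ.descendants (Fin.last n)).elementaryDifferential f x = f x := by
  rw [τ.elementaryDifferential_descendants hf (Fin.last n) (e := Fin.elim0)
    (fun i => i.elim0) (by simp [children_last])]
  simp

/-- The new leaf lies only above `l` and its ancestors; all other subtrees are unchanged. -/
theorem elementaryDifferential_attach_of_notMem (hf : ContDiff ℝ ∞ f) {l v : Fin n}
    (h : l ∉ τ.subtree v) (x : E) :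
    ((τ.attach l).descendants v.castSucc).elementaryDifferential f x
      = (τ.descendants v).elementaryDifferential f x := by
  induction v using τ.children_induction with
  | h v ih =>
    have hlv : l ≠ v := fun h' => h (h' ▸ τ.self_mem_subtree v)
    rw [(τ.attach l).elementaryDifferential_descendants hf v.castSucc
      (e := fun i => ((τ.children v).orderEmbOfFin rfl i).castSucc),
      τ.elementaryDifferential_descendants hf v ((τ.children v).orderEmbOfFin rfl).injective]
    · congr 1
      funext i
      have hi := Finset.orderEmbOfFin_mem (τ.children v) rfl i
      exact ih _ hi fun hl => h (τ.mem_subtree_iff.2 (.inr ⟨_, hi, hl⟩))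
    · intro w
      rw [← Set.mem_range, Finset.range_orderEmbOfFin, Finset.mem_coe]
    · exact (Fin.castSucc_injective n).comp ((τ.children v).orderEmbOfFin rfl).injective
    · intro w
      induction w using Fin.lastCases with
      | last => simp [last_mem_children_attach, hlv, Fin.castSucc_ne_last]
      | cast w =>
        rw [castSucc_mem_children_attach, ← Finset.mem_coe,
          ← Finset.range_orderEmbOfFin (τ.children v) rfl, Set.mem_range]
        simp only [Fin.castSucc_inj]

/-- Differentiating an elementary differential along `f` attaches a new vertex in all possible
ways. -/
theorem fderiv_elementaryDifferential_descendants (hf : ContDiff ℝ ∞ f) (v : Fin n) (x : E) :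
    fderiv ℝ ((τ.descendants v).elementaryDifferential f) x (f x)
      = ∑ l ∈ τ.subtree v,
          ((τ.attach l).descendants v.castSucc).elementaryDifferential f x := by
  classical
  induction v using τ.children_induction with
  | h v ih =>
    set e := (τ.children v).orderEmbOfFin rfl with he
    have hmem : ∀ i, e i ∈ τ.children v := Finset.orderEmbOfFin_mem (τ.children v) rfl
    have hr : ∀ w, w ∈ τ.children v ↔ ∃ i, e i = w := fun w => by
      rw [← Set.mem_range, Finset.range_orderEmbOfFin, Finset.mem_coe]
    have h0 : (τ.descendants v).elementaryDifferential f = fun y => iteratedFDeriv ℝ _ f y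
        fun i => (τ.descendants (e i)).elementaryDifferential f y :=
      funext (τ.elementaryDifferential_descendants hf v e.injective hr)
    rw [h0, fderiv_iteratedFDeriv_apply hf fun i =>
      (OrderedTree.contDiff_elementaryDifferential hf _).differentiable (by simp),
      subtree_eq, Finset.sum_insert (τ.notMem_biUnion_subtree v),
      Finset.sum_biUnion (τ.pairwiseDisjoint_subtree v)]
    congr 1
    -- The term `l = v`: the derivative falls on `∇ᵐ f`, and the extra argument `f x` is the new
    -- leaf. It is listed first although its label is the largest, which symmetry allows.
    · rw [(τ.attach v).elementaryDifferential_descendants hf v.castSucc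
        (e := Fin.cons (Fin.last n) fun i => (e i).castSucc)]
      · congr 1
        funext i
        induction i using Fin.cases with
        | zero => simp [elementaryDifferential_descendants_last _ hf]
        | succ i =>
          simp [τ.elementaryDifferential_attach_of_notMem hf
            (τ.notMem_subtree_of_mem_children (hmem i))]
      · rw [Fin.cons_injective_iff]
        refine ⟨?_, (Fin.castSucc_injective n).comp e.injective⟩
        rintro ⟨i, hi⟩
        exact Fin.castSucc_ne_last _ hi
      · intro w
        induction w using Fin.lastCases with
        | last => simp [last_mem_children_attach, Fin.exists_fin_succ]
        | cast w =>
          rw [castSucc_mem_children_attach, hr]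
          simp [Fin.exists_fin_succ, (Fin.castSucc_ne_last _).symm]
    -- The derivative falls on branch `i`: by induction the leaf is attached inside that branch, and
    -- disjointness leaves its siblings unchanged.
    · have hsum : ∀ F : Fin n → E, ∑ w ∈ τ.children v, F w = ∑ i, F (e i) := fun F => by
        conv_lhs => rw [← Finset.map_orderEmbOfFin_univ (τ.children v) rfl, Finset.sum_map]
        rfl
      rw [hsum]
      refine Finset.sum_congr rfl fun i _ => ?_
      rw [ih _ (hmem i)]
      refine ((iteratedFDeriv ℝ _ f x).toMultilinearMap.map_update_sum _ i _ _).trans ?_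
      refine Finset.sum_congr rfl fun l hl => ?_
      have hlv : l ≠ v := fun h => τ.notMem_subtree_of_mem_children (hmem i) (h ▸ hl)
      rw [(τ.attach l).elementaryDifferential_descendants hf v.castSucc
        (e := fun i => (e i).castSucc)]
      · refine congrArg (iteratedFDeriv ℝ _ f x) (funext fun j => ?_)
        rcases eq_or_ne j i with rfl | hj
        · simp
        · rw [Function.update_of_ne hj, τ.elementaryDifferential_attach_of_notMem hf]
          exact Finset.disjoint_left.1 (τ.pairwiseDisjoint_subtree v (hmem i) (hmem j)
            fun h => hj (e.injective h).symm) hl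
      · exact (Fin.castSucc_injective n).comp e.injective
      · intro w
        induction w using Fin.lastCases with
        | last => simp [last_mem_children_attach, hlv, Fin.castSucc_ne_last]
        | cast w =>
          rw [castSucc_mem_children_attach, hr]
          simp

/-- One operator norm, hence one factor `C`, per vertex. -/
theorem norm_elementaryDifferential_descendants_le {C : ℝ} {x : E}
    (hbound : ∀ m : ℕ, ‖iteratedFDeriv ℝ m f x‖ ≤ C) (v : Fin n) :
    ‖(τ.descendants v).elementaryDifferential f x‖ ≤ C ^ (τ.subtree v).card := by
  classical
  have hC : 0 ≤ C := (norm_nonneg _).trans (hbound 0)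
  induction v using τ.children_induction with
  | h v ih =>
    rw [subtree_eq, Finset.card_insert_of_notMem (τ.notMem_biUnion_subtree v),
      Finset.card_biUnion (τ.pairwiseDisjoint_subtree v), pow_succ', ← Finset.prod_pow_eq_pow_sum,
      descendants, OrderedTree.elementaryDifferential]
    refine (ContinuousMultilinearMap.le_opNorm _ _).trans
      (mul_le_mul (hbound _) ?_ (Finset.prod_nonneg fun _ _ => norm_nonneg _) hC)
    conv_rhs => rw [← Finset.map_orderEmbOfFin_univ (τ.children v) rfl, Finset.prod_map]
    exact Finset.prod_le_prod (fun _ _ => norm_nonneg _) fun i _ =>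
      ih _ (Finset.orderEmbOfFin_mem (τ.children v) rfl i)

end

end LabelledTree

end Butcher

namespace Butcher

/-! ### Finite expectations and the law of the random tree. -/

section PMF

variable {α β E : Type*} [AddCommGroup E] [Module ℝ E]

theorem sum_toReal_bind_smul [Fintype α] [Fintype β] (p : PMF α) (q : α → PMF β) (g : β → E) :
    ∑ b, (p.bind q b).toReal • g b = ∑ a, (p a).toReal • ∑ b, (q a b).toReal • g b := by
  simp only [PMF.bind_apply, tsum_fintype]
  have h : ∀ b, (∑ a, p a * q a b).toReal = ∑ a, (p a).toReal * (q a b).toReal := fun b => by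
    rw [ENNReal.toReal_sum fun a _ => ENNReal.mul_ne_top (p.apply_ne_top a) ((q a).apply_ne_top b)]
    simp
  simp only [h, Finset.sum_smul, Finset.smul_sum, smul_smul]
  exact Finset.sum_comm

theorem sum_toReal_pure_smul [Fintype α] (a : α) (g : α → E) :
    ∑ b, (PMF.pure a b).toReal • g b = g a := by
  classical
  rw [Finset.sum_eq_single a] <;> simp +contextual [PMF.pure_apply]

theorem sum_toReal_map_smul [Fintype α] [Fintype β] (p : PMF α) (φ : α → β) (g : β → E) :
    ∑ b, (p.map φ b).toReal • g b = ∑ a, (p a).toReal • g (φ a) := by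
  simp only [PMF.map, sum_toReal_bind_smul, Function.comp_apply, sum_toReal_pure_smul]

theorem sum_toReal [Fintype α] (p : PMF α) : ∑ a, (p a).toReal = 1 := by
  rw [← ENNReal.toReal_sum fun a _ => p.apply_ne_top a, ← tsum_fintype (L := .unconditional _),
    p.tsum_coe, ENNReal.toReal_one]

/-- The index can be read off from the pair, so a single term of each sum survives. -/
theorem bind_map_sigmaMk_apply {ι : Type*} {β : ι → Type*} (p : PMF ι) (q : ∀ i, PMF (β i))
    (i : ι) (b : β i) : (p.bind fun i => (q i).map (Sigma.mk i)) ⟨i, b⟩ = p i * q i b := by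
  classical
  rw [PMF.bind_apply, tsum_eq_single i]
  · rw [PMF.map_apply, tsum_eq_single b]
    · rw [if_pos rfl]
    · exact fun b' h => if_neg fun h' => h (sigma_mk_injective h').symm
  · intro j hj
    rw [PMF.map_apply, ENNReal.tsum_eq_zero.2, mul_zero]
    exact fun b' => if_neg fun h' => hj (congrArg Sigma.fst h').symm

end PMF

instance (n : ℕ) : Finite (LabelledTree n) :=
  Finite.of_injective LabelledTree.parent fun _ _ h => LabelledTree.ext h

noncomputable instance (n : ℕ) : Fintype (LabelledTree n) := Fintype.ofFinite _

instance : Countable AnyLabelledTree := inferInstanceAs (Countable (Σ n : ℕ, LabelledTree n))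

instance : DiscreteMeasurableSpace AnyLabelledTree := ⟨fun _ => trivial⟩

theorem randomTree_apply (p : PMF ℕ) (n : ℕ) (τ : LabelledTree n) :
    randomTree p (⟨n, τ⟩ : Σ n : ℕ, LabelledTree n) = p n * uniformAttachment n τ :=
  bind_map_sigmaMk_apply p uniformAttachment n τ

/-! ### Averages over trees as derivatives along the flow. -/

section

variable {E : Type*} [NormedAddCommGroup E] [NormedSpace ℝ E] {f : E → E}

/-- The `n`-th derivative along the solutions of `x' = f(x)`, as a function of the position. -/
noncomputable def flowDerivative (f : E → E) : ℕ → E → E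
  | 0 => id
  | n + 1 => fun x => fderiv ℝ (flowDerivative f n) x (f x)

theorem contDiff_flowDerivative (hf : ContDiff ℝ ∞ f) (n : ℕ) :
    ContDiff ℝ ∞ (flowDerivative f n) := by
  induction n with
  | zero => exact contDiff_id
  | succ n ih => exact (ih.fderiv_right (m := ∞) (by norm_cast)).clm_apply hf

/-- Each attachment has probability `1 / (n + 1)`, and the sum over all attachments is one more
derivative along `f`; hence the factorial. -/
theorem sum_uniformAttachment_descendants (hf : ContDiff ℝ ∞ f) (n : ℕ) (x : E) :
    ∑ τ, (uniformAttachment (n + 1) τ).toReal • (τ.descendants 0).elementaryDifferential f x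
      = (n.factorial : ℝ)⁻¹ • flowDerivative f (n + 1) x := by
  induction n generalizing x with
  | zero =>
    have h := LabelledTree.single.elementaryDifferential_descendants_last hf x
    simp only [uniformAttachment]
    rw [sum_toReal_pure_smul]
    simpa [flowDerivative] using h
  | succ n ih =>
    have hd : ∀ τ : LabelledTree (n + 1),
        DifferentiableAt ℝ ((τ.descendants 0).elementaryDifferential f) x := fun τ =>
      (OrderedTree.contDiff_elementaryDifferential hf _).differentiable (by simp) x
    have hfd : fderiv ℝ (fun y => (n.factorial : ℝ)⁻¹ • flowDerivative f (n + 1) y) x (f x)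
        = ∑ τ : LabelledTree (n + 1), (uniformAttachment (n + 1) τ).toReal •
          fderiv ℝ ((τ.descendants 0).elementaryDifferential f) x (f x) := by
      simp only [← ih]
      rw [fderiv_fun_sum fun τ _ => (hd τ).fun_const_smul _, sum_apply]
      refine Finset.sum_congr rfl fun τ _ => ?_
      rw [fderiv_fun_const_smul (hd τ)]
      rfl
    rw [fderiv_fun_const_smul ((contDiff_flowDerivative hf _).differentiable (by simp) x)] at hfd
    have hu : ∀ l : Fin (n + 1), (PMF.uniformOfFintype (Fin (n + 1)) l).toReal
        = ((n + 1 : ℕ) : ℝ)⁻¹ := fun l => by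
      rw [PMF.uniformOfFintype_apply, Fintype.card_fin, ENNReal.toReal_inv, ENNReal.toReal_natCast]
    simp only [uniformAttachment, sum_toReal_bind_smul, sum_toReal_map_smul, hu]
    rw [Nat.factorial_succ, Nat.cast_mul, mul_inv, mul_smul]
    simp only [flowDerivative]
    refine Eq.trans ?_ (congrArg (((n + 1 : ℕ) : ℝ)⁻¹ • ·) hfd.symm)
    simp only [Finset.smul_sum]
    refine Finset.sum_congr rfl fun τ _ => ?_
    rw [τ.fderiv_elementaryDifferential_descendants hf 0 x, τ.subtree_root, Finset.smul_sum,
      Finset.smul_sum]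
    exact Finset.sum_congr rfl fun l _ => smul_comm _ _ _

theorem sum_uniformAttachment_elementaryDifferential (hf : ContDiff ℝ ∞ f) (n : ℕ) (x : E) :
    ∑ τ, (uniformAttachment n τ).toReal • elementaryDifferential f hf τ.forget x
      = (((max n 1 : ℕ) : ℝ) / n.factorial) • flowDerivative f n x := by
  cases n with
  | zero =>
    simp only [uniformAttachment]
    rw [sum_toReal_pure_smul]
    simp [LabelledTree.forget, elementaryDifferential, flowDerivative]
  | succ n =>
    refine (sum_uniformAttachment_descendants hf n x).trans ?_
    congr 1
    rw [max_eq_left (by omega), Nat.factorial_succ, Nat.cast_mul]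
    have : ((n + 1 : ℕ) : ℝ) ≠ 0 := by positivity
    field_simp

/-- The factor `‖x‖ + 1` is there for the empty tree, whose differential is the identity; nonempty
trees satisfy the bound without it. -/
theorem norm_elementaryDifferential_forget_le (hf : ContDiff ℝ ∞ f) {C : ℝ} {x : E}
    (hbound : ∀ m : ℕ, ‖iteratedFDeriv ℝ m f x‖ ≤ C) {n : ℕ} (τ : LabelledTree n) :
    ‖elementaryDifferential f hf τ.forget x‖ ≤ (‖x‖ + 1) * C ^ n := by
  cases n with
  | zero => simp [LabelledTree.forget, elementaryDifferential]
  | succ n =>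
    have h := τ.norm_elementaryDifferential_descendants_le hbound 0
    rw [τ.subtree_root, Finset.card_univ, Fintype.card_fin] at h
    exact h.trans (le_mul_of_one_le_left ((norm_nonneg _).trans h) (by simp))

/-- The Taylor coefficients are averages of elementary differentials, up to the factor `max n 1 ≥
1`, and inherit their bound. -/
theorem norm_flowDerivative_le (hf : ContDiff ℝ ∞ f) {C : ℝ} {x : E}
    (hbound : ∀ m : ℕ, ‖iteratedFDeriv ℝ m f x‖ ≤ C) (n : ℕ) :
    ‖((n.factorial : ℝ)⁻¹ • flowDerivative f n x)‖ ≤ (‖x‖ + 1) * C ^ n := by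
  have hC : 0 ≤ C := (norm_nonneg _).trans (hbound 0)
  have h1 : (1 : ℝ) ≤ ((max n 1 : ℕ) : ℝ) := by exact_mod_cast le_max_right n 1
  have h := sum_uniformAttachment_elementaryDifferential hf n x
  rw [div_eq_mul_inv, mul_smul] at h
  calc ‖((n.factorial : ℝ)⁻¹ • flowDerivative f n x)‖
      ≤ ‖((max n 1 : ℕ) : ℝ) • ((n.factorial : ℝ)⁻¹ • flowDerivative f n x)‖ := by
        rw [norm_smul ((max n 1 : ℕ) : ℝ), Real.norm_natCast]
        exact le_mul_of_one_le_left (norm_nonneg _) h1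
    _ ≤ ∑ τ : LabelledTree n, (uniformAttachment n τ).toReal * ((‖x‖ + 1) * C ^ n) := by
        rw [← h]
        refine norm_sum_le_of_le _ fun τ _ => ?_
        rw [norm_smul, Real.norm_of_nonneg ENNReal.toReal_nonneg]
        exact mul_le_mul_of_nonneg_left (norm_elementaryDifferential_forget_le hf hbound τ)
          ENNReal.toReal_nonneg
    _ = (‖x‖ + 1) * C ^ n := by rw [← Finset.sum_mul, sum_toReal, one_mul]

theorem enorm_treeFunctional_mul_le (hf : ContDiff ℝ ∞ f) {C : ℝ} {x₀ : E}
    (hbound : ∀ m : ℕ, ‖iteratedFDeriv ℝ m f x₀‖ ≤ C) {p : PMF ℕ} (hp : ∀ n, 0 < p n)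
    {t₀ t : ℝ} (ht : t₀ ≤ t) {n : ℕ} (τ : LabelledTree n) :
    p n * ‖treeFunctional f hf p t₀ x₀ t ⟨n, τ⟩‖ₑ
      ≤ ENNReal.ofReal ((‖x₀‖ + 1) * ((t - t₀) * C) ^ n) := by
  have hC : 0 ≤ C := (norm_nonneg _).trans (hbound 0)
  have hpn : 0 < (p n).toReal := ENNReal.toReal_pos (hp n).ne' (p.apply_ne_top n)
  have h1 : (1 : ℝ) ≤ ((max n 1 : ℕ) : ℝ) := by exact_mod_cast le_max_right n 1
  have h0 : 0 ≤ (t - t₀) ^ n := pow_nonneg (sub_nonneg.2 ht) n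
  rw [← ENNReal.ofReal_toReal (p.apply_ne_top n), ← ofReal_norm,
    ← ENNReal.ofReal_mul hpn.le]
  refine ENNReal.ofReal_le_ofReal ?_
  simp only [treeFunctional, AnyLabelledTree.order, AnyLabelledTree.forget, norm_smul]
  rw [Real.norm_of_nonneg (by positivity)]
  have h2 := norm_elementaryDifferential_forget_le hf hbound τ
  calc (p n).toReal * ((t - t₀) ^ n / (((max n 1 : ℕ) : ℝ) * (p n).toReal)
          * ‖elementaryDifferential f hf τ.forget x₀‖)
      = (t - t₀) ^ n / ((max n 1 : ℕ) : ℝ) * ‖elementaryDifferential f hf τ.forget x₀‖ := by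
        field_simp
    _ ≤ (t - t₀) ^ n * ((‖x₀‖ + 1) * C ^ n) := by
        gcongr
        exact div_le_self h0 h1
    _ = (‖x₀‖ + 1) * ((t - t₀) * C) ^ n := by rw [mul_pow]; ring

theorem tsum_enorm_treeFunctional_ne_top (hf : ContDiff ℝ ∞ f) {C : ℝ} (hC : 0 < C) {x₀ : E}
    (hbound : ∀ m : ℕ, ‖iteratedFDeriv ℝ m f x₀‖ ≤ C) {p : PMF ℕ} (hp : ∀ n, 0 < p n)
    {t₀ t : ℝ} (ht : t ∈ Set.Ico t₀ (t₀ + 1 / C)) :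
    ∑' τ : AnyLabelledTree, randomTree p τ * ‖treeFunctional f hf p t₀ x₀ t τ‖ₑ ≠ ⊤ := by
  have hr0 : 0 ≤ (t - t₀) * C := mul_nonneg (sub_nonneg.2 ht.1) hC.le
  have hr1 : (t - t₀) * C < 1 := by
    rw [← lt_div_iff₀ hC]
    linarith [ht.2]
  have hs : Summable fun n : ℕ => (‖x₀‖ + 1) * ((t - t₀) * C) ^ n :=
    (summable_geometric_of_lt_one hr0 hr1).mul_left _
  refine ne_top_of_le_ne_top hs.tsum_ofReal_ne_top ?_
  refine (ENNReal.tsum_sigma (β := LabelledTree) fun n τ => randomTree p ⟨n, τ⟩ *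
    ‖treeFunctional f hf p t₀ x₀ t ⟨n, τ⟩‖ₑ).trans_le (ENNReal.tsum_le_tsum fun n => ?_)
  calc ∑' τ, randomTree p ⟨n, τ⟩ * ‖treeFunctional f hf p t₀ x₀ t ⟨n, τ⟩‖ₑ
      ≤ ∑' τ, uniformAttachment n τ *
          ENNReal.ofReal ((‖x₀‖ + 1) * ((t - t₀) * C) ^ n) := by
        refine ENNReal.tsum_le_tsum fun τ => ?_
        rw [randomTree_apply, mul_comm (p n), mul_assoc]
        exact mul_le_mul_right (enorm_treeFunctional_mul_le hf hbound hp ht.1 τ) _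
    _ = _ := by rw [ENNReal.tsum_mul_right, PMF.tsum_coe, one_mul]

theorem integrable_treeFunctional (hf : ContDiff ℝ ∞ f) {C : ℝ} (hC : 0 < C) {x₀ : E}
    (hbound : ∀ m : ℕ, ‖iteratedFDeriv ℝ m f x₀‖ ≤ C) {p : PMF ℕ} (hp : ∀ n, 0 < p n)
    {t₀ t : ℝ} (ht : t ∈ Set.Ico t₀ (t₀ + 1 / C)) :
    Integrable (treeFunctional f hf p t₀ x₀ t) (randomTree p).toMeasure := by
  refine ⟨.of_discrete, ?_⟩
  rw [HasFiniteIntegral, lintegral_countable', lt_top_iff_ne_top]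
  simp only [PMF.toMeasure_apply_singleton _ _ (MeasurableSet.singleton _), mul_comm ‖_‖ₑ]
  exact tsum_enorm_treeFunctional_ne_top hf hC hbound hp ht

theorem integral_treeFunctional [CompleteSpace E] (hf : ContDiff ℝ ∞ f) {C : ℝ} (hC : 0 < C)
    {x₀ : E} (hbound : ∀ m : ℕ, ‖iteratedFDeriv ℝ m f x₀‖ ≤ C) {p : PMF ℕ} (hp : ∀ n, 0 < p n)
    {t₀ t : ℝ} (ht : t ∈ Set.Ico t₀ (t₀ + 1 / C)) :
    ∫ τ, treeFunctional f hf p t₀ x₀ t τ ∂(randomTree p).toMeasure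
      = ∑' n : ℕ, (t - t₀) ^ n • ((n.factorial : ℝ)⁻¹ • flowDerivative f n x₀) := by
  rw [PMF.integral_eq_tsum _ _ (integrable_treeFunctional hf hC hbound hp ht)]
  have hs : Summable fun τ : AnyLabelledTree =>
      (randomTree p τ).toReal • treeFunctional f hf p t₀ x₀ t τ := by
    refine .of_norm ((ENNReal.summable_toReal
      (tsum_enorm_treeFunctional_ne_top hf hC hbound hp ht)).congr fun τ => ?_)
    rw [norm_smul, Real.norm_of_nonneg ENNReal.toReal_nonneg, ENNReal.toReal_mul, toReal_enorm]
  refine (Summable.tsum_sigma (γ := LabelledTree) hs).trans (tsum_congr fun n => ?_)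
  have hpn : (p n).toReal ≠ 0 := (ENNReal.toReal_pos (hp n).ne' (p.apply_ne_top n)).ne'
  have hmax : ((max n 1 : ℕ) : ℝ) ≠ 0 := by positivity
  calc ∑' τ, (randomTree p ⟨n, τ⟩).toReal • treeFunctional f hf p t₀ x₀ t ⟨n, τ⟩
      = ∑ τ : LabelledTree n, ((t - t₀) ^ n / ((max n 1 : ℕ) : ℝ)) •
          (uniformAttachment n τ).toReal • elementaryDifferential f hf τ.forget x₀ := by
        rw [tsum_fintype]
        refine Finset.sum_congr rfl fun τ _ => ?_
        rw [randomTree_apply, ENNReal.toReal_mul]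
        simp only [treeFunctional, AnyLabelledTree.order, AnyLabelledTree.forget, smul_smul]
        congr 1
        field_simp
    _ = _ := by
        rw [← Finset.smul_sum, sum_uniformAttachment_elementaryDifferential, smul_smul, smul_smul]
        congr 1
        field_simp

end

end Butcher

namespace Butcher

/-! ### Functions vanishing to infinite order on one side. -/

section Flat

open Filter Topology Set Asymptotics

variable {E : Type*} [NormedAddCommGroup E] [NormedSpace ℝ E]

/-- An analytic function which vanishes to infinite order on one side of a point vanishes near
this point. -/
theorem _root_.AnalyticAt.eventually_eq_zero_of_isBigO_pow {u : ℝ → E} {a : ℝ}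
    (hu : AnalyticAt ℝ u a) (h : ∀ n : ℕ, u =O[𝓝[>] a] fun t => (t - a) ^ n) :
    ∀ᶠ t in 𝓝 a, u t = 0 := by
  by_contra hne
  -- Otherwise `u = (t - a) ^ n • g` with `g a ≠ 0`; the bound of order `n + 1` forces `g a = 0`.
  obtain ⟨n, g, hg, hg0, hug⟩ := hu.exists_eventuallyEq_pow_smul_nonzero_iff.2 hne
  obtain ⟨K, hK⟩ := (h (n + 1)).bound
  have hle : ∀ᶠ t in 𝓝[>] a, ‖g t‖ ≤ K * (t - a) := by
    filter_upwards [hK, hug.filter_mono nhdsWithin_le_nhds, self_mem_nhdsWithin] with t h1 h2 h3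
    have h4 : 0 < t - a := sub_pos.2 h3
    rw [h2, norm_smul, Real.norm_of_nonneg (by positivity), Real.norm_of_nonneg (by positivity),
      pow_succ] at h1
    refine le_of_mul_le_mul_left (h1.trans_eq ?_) (pow_pos h4 n)
    ring
  have hlim : Tendsto (fun t => K * (t - a)) (𝓝[>] a) (𝓝 0) := by
    have : Tendsto (fun t => K * (t - a)) (𝓝 a) (𝓝 (K * (a - a))) :=
      (continuous_const.mul (continuous_id.sub continuous_const)).tendsto a
    simpa using this.mono_left nhdsWithin_le_nhds
  have h0 := le_of_tendsto_of_tendsto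
    (hg.continuousAt.norm.tendsto.mono_left nhdsWithin_le_nhds) hlim hle
  exact hg0 (norm_le_zero_iff.1 h0)

/-- A smooth function all of whose derivatives vanish at the left endpoint of an interval vanishes
there to infinite order. -/
theorem isBigO_pow_of_iteratedDerivWithin_eq_zero {u : ℝ → E} {a b : ℝ} (hab : a < b)
    (hu : ContDiffOn ℝ ∞ u (Icc a b)) (h : ∀ k, iteratedDerivWithin k u (Icc a b) a = 0) (n : ℕ) :
    u =O[𝓝[>] a] fun t => (t - a) ^ n := by
  cases n with
  | zero =>
    simp only [pow_zero]
    have h1 : Tendsto u (𝓝[>] a) (𝓝 (u a)) :=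
      ((hu.continuousOn a (left_mem_Icc.2 hab.le)).mono_of_mem_nhdsWithin
        (Icc_mem_nhdsGT hab)).tendsto
    exact h1.isBigO_one ℝ
  | succ n =>
    obtain ⟨K, hK⟩ := exists_taylor_mean_remainder_bound (n := n) hab.le
      (hu.of_le (by exact_mod_cast le_top))
    refine .of_bound K ?_
    filter_upwards [Icc_mem_nhdsGT hab] with t ht
    have h1 := hK t ht
    rw [taylor_within_apply, Finset.sum_eq_zero fun k _ => by rw [h k, smul_zero], sub_zero] at h1
    rwa [Real.norm_of_nonneg (pow_nonneg (sub_nonneg.2 ht.1) _)]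

end Flat

/-! ### The power series with geometrically bounded coefficients. -/

section PowerSeries

variable {E : Type*} [NormedAddCommGroup E] [NormedSpace ℝ E] [CompleteSpace E]

theorem hasFPowerSeriesOnBall_tsum_pow_smul {a : ℕ → E} {B C : ℝ} (hC : 0 < C)
    (ha : ∀ n, ‖a n‖ ≤ B * C ^ n) (t₀ : ℝ) :
    HasFPowerSeriesOnBall (fun t => ∑' n : ℕ, (t - t₀) ^ n • a n)
      (fun n => ContinuousMultilinearMap.mkPiRing ℝ (Fin n) (a n)) t₀
      (ENNReal.ofReal (1 / C)) := by
  set q : FormalMultilinearSeries ℝ ℝ E :=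
    fun n => ContinuousMultilinearMap.mkPiRing ℝ (Fin n) (a n) with hq
  have hr : ENNReal.ofReal (1 / C) ≤ q.radius := by
    refine q.le_radius_of_bound B fun n => ?_
    rw [hq, ContinuousMultilinearMap.norm_mkPiRing, Real.coe_toNNReal _ (by positivity)]
    calc ‖a n‖ * (1 / C) ^ n ≤ B * C ^ n * (1 / C) ^ n := by gcongr; exact ha n
      _ = B := by rw [mul_assoc, ← mul_pow, mul_one_div_cancel hC.ne', one_pow, mul_one]
  have h0 : 0 < ENNReal.ofReal (1 / C) := ENNReal.ofReal_pos.2 (by positivity)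
  have h := ((q.hasFPowerSeriesOnBall (h0.trans_le hr)).mono h0 hr).comp_sub t₀
  rw [zero_add] at h
  refine h.congr fun t _ => ?_
  simp [FormalMultilinearSeries.sum, hq]

theorem analyticOnNhd_tsum_pow_smul {a : ℕ → E} {B C : ℝ} (hC : 0 < C)
    (ha : ∀ n, ‖a n‖ ≤ B * C ^ n) (t₀ : ℝ) :
    AnalyticOnNhd ℝ (fun t => ∑' n : ℕ, (t - t₀) ^ n • a n)
      (Set.Ioo (t₀ - 1 / C) (t₀ + 1 / C)) := by
  have h := (hasFPowerSeriesOnBall_tsum_pow_smul hC ha t₀).analyticOnNhd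
  rwa [Metric.eball_ofReal, Real.ball_eq_Ioo] at h

theorem iteratedDeriv_tsum_pow_smul {a : ℕ → E} {B C : ℝ} (hC : 0 < C)
    (ha : ∀ n, ‖a n‖ ≤ B * C ^ n) (t₀ : ℝ) (n : ℕ) :
    iteratedDeriv n (fun t => ∑' n : ℕ, (t - t₀) ^ n • a n) t₀ = (n.factorial : ℝ) • a n := by
  rw [iteratedDeriv_eq_iteratedFDeriv,
    ← (hasFPowerSeriesOnBall_tsum_pow_smul hC ha t₀).factorial_smul 1 n]
  simp [Nat.cast_smul_eq_nsmul]

end PowerSeries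

/-! ### Comparison of solutions with the power series. -/

section Solution

open Filter Topology Set Asymptotics

variable {E : Type*} [NormedAddCommGroup E] [NormedSpace ℝ E] {f : E → E} {t₀ T : ℝ} {x₀ : E}
  {x y : ℝ → E}

theorem iteratedDerivWithin_eq_flowDerivative (hf : ContDiff ℝ ∞ f) (hT : t₀ < T)
    (hx : ∀ t ∈ Icc t₀ T, HasDerivWithinAt x (f (x t)) (Icc t₀ T) t) (n : ℕ) :
    ∀ t ∈ Icc t₀ T, iteratedDerivWithin n x (Icc t₀ T) t = flowDerivative f n (x t) := by
  induction n with
  | zero => intro t _; simp [flowDerivative]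
  | succ n ih =>
    intro t ht
    rw [iteratedDerivWithin_succ, derivWithin_congr ih (ih t ht)]
    have h := ((contDiff_flowDerivative hf n).differentiable (by simp)
      (x t)).hasFDerivAt.comp_hasDerivWithinAt t (hx t ht)
    exact h.derivWithin (uniqueDiffOn_Icc hT t ht)

theorem contDiffOn_of_hasDerivWithinAt_autonomous (hf : ContDiff ℝ ∞ f) (hT : t₀ < T)
    (hx : ∀ t ∈ Icc t₀ T, HasDerivWithinAt x (f (x t)) (Icc t₀ T) t) :
    ContDiffOn ℝ ∞ x (Icc t₀ T) := by
  refine contDiffOn_of_differentiableOn_deriv fun n _ => ?_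
  have hd : DifferentiableOn ℝ x (Icc t₀ T) := fun t ht => (hx t ht).differentiableWithinAt
  exact (((contDiff_flowDerivative hf n).differentiable (by simp)).comp_differentiableOn hd).congr
    (iteratedDerivWithin_eq_flowDerivative hf hT hx n)

namespace IsSolution

theorem mono (hx : IsSolution f t₀ T x₀ x) {T' : ℝ} (hT' : T' ≤ T) : IsSolution f t₀ T' x₀ x where
  continuousOn := hx.continuousOn.mono (Icc_subset_Icc_right hT')
  initial := hx.initial
  hasDeriv t ht := (hx.hasDeriv t ⟨ht.1, ht.2.trans hT'⟩).mono (Icc_subset_Icc_right hT')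

theorem hasDerivAt (hx : IsSolution f t₀ T x₀ x) {t : ℝ} (ht : t ∈ Ioo t₀ T) :
    HasDerivAt x (f (x t)) t :=
  (hx.hasDeriv t ⟨ht.1, ht.2.le⟩).hasDerivAt (Icc_mem_nhds ht.1 ht.2)

/-- `IsSolution` requires no derivative at `t₀`; it exists because `x'` tends to `f x₀` there. -/
theorem hasDerivWithinAt_left (hf : Continuous f) (hT : t₀ < T) (hx : IsSolution f t₀ T x₀ x) :
    HasDerivWithinAt x (f x₀) (Ici t₀) t₀ := by
  have hc := (hx.continuousOn t₀ (left_mem_Icc.2 hT.le))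
  refine hasDerivWithinAt_Ici_of_tendsto_deriv (s := Ioo t₀ T)
    (fun t ht => (hx.hasDerivAt ht).differentiableAt.differentiableWithinAt)
    (hc.mono Ioo_subset_Icc_self) (Ioo_mem_nhdsGT hT) ?_
  have h : Tendsto (fun t => f (x t)) (𝓝[>] t₀) (𝓝 (f x₀)) := by
    rw [← hx.initial]
    exact (hf.tendsto _).comp (hc.mono_of_mem_nhdsWithin (Icc_mem_nhdsGT hT)).tendsto
  refine h.congr' ?_
  filter_upwards [Ioo_mem_nhdsGT hT] with t ht using (hx.hasDerivAt ht).deriv.symm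

theorem hasDerivWithinAt_Icc (hf : Continuous f) (hT : t₀ < T) (hx : IsSolution f t₀ T x₀ x) :
    ∀ t ∈ Icc t₀ T, HasDerivWithinAt x (f (x t)) (Icc t₀ T) t := fun t ht => by
  rcases ht.1.eq_or_lt with rfl | h
  · rw [hx.initial]
    exact (hx.hasDerivWithinAt_left hf hT).mono Icc_subset_Ici_self
  · exact hx.hasDeriv t ⟨h, ht.2⟩

theorem hasDerivWithinAt_Ici (hf : Continuous f) (hT : t₀ < T) (hx : IsSolution f t₀ T x₀ x) :
    ∀ t ∈ Ico t₀ T, HasDerivWithinAt x (f (x t)) (Ici t) t := fun t ht => by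
  rcases ht.1.eq_or_lt with rfl | h
  · rw [hx.initial]
    exact hx.hasDerivWithinAt_left hf hT
  · exact (hx.hasDerivAt ⟨h, ht.2⟩).hasDerivWithinAt

/-- Uniqueness of solutions of an autonomous equation with a smooth right-hand side. -/
theorem eqOn [ProperSpace E] (hf : ContDiff ℝ 1 f) (hT : t₀ < T) (hx : IsSolution f t₀ T x₀ x)
    (hy : IsSolution f t₀ T x₀ y) : EqOn x y (Icc t₀ T) := by
  -- Both trajectories are compact, so one ball contains them, and `f` is Lipschitz on it.
  obtain ⟨R, hR⟩ := (isCompact_Icc.image_of_continuousOn hx.continuousOn).isBounded.union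
    (isCompact_Icc.image_of_continuousOn hy.continuousOn).isBounded |>.subset_closedBall 0
  obtain ⟨K, hK⟩ := (hf.contDiffOn (s := Metric.closedBall (0 : E) R)).exists_lipschitzOnWith
    one_ne_zero (convex_closedBall _ _) (isCompact_closedBall _ _)
  exact ODE_solution_unique_of_mem_Icc_right (v := fun _ => f)
    (s := fun _ => Metric.closedBall (0 : E) R) (fun _ _ => hK) hx.continuousOn
    (hx.hasDerivWithinAt_Ici hf.continuous hT)
    (fun t ht => hR (.inl (mem_image_of_mem x (Ico_subset_Icc_self ht)))) hy.continuousOn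
    (hy.hasDerivWithinAt_Ici hf.continuous hT)
    (fun t ht => hR (.inr (mem_image_of_mem y (Ico_subset_Icc_self ht))))
    (hx.initial.trans hy.initial.symm)

/-- A solution and a smooth function with the same derivatives at the initial time agree to
infinite order there, and so do their derivatives. -/
theorem isBigO_pow_sub [CompleteSpace E] (hf : ContDiff ℝ ∞ f) (hT : t₀ < T)
    (hx : IsSolution f t₀ T x₀ x) {S : ℝ → E} (hS : ∀ᶠ t in 𝓝 t₀, AnalyticAt ℝ S t)
    (hjet : ∀ n, iteratedDeriv n S t₀ = flowDerivative f n x₀) (n : ℕ) :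
    ((fun t => x t - S t) =O[𝓝[>] t₀] fun t => (t - t₀) ^ n) ∧
      ((fun t => f (x t) - deriv S t) =O[𝓝[>] t₀] fun t => (t - t₀) ^ n) := by
  obtain ⟨ε, hε, hεS⟩ := Metric.eventually_nhds_iff_ball.1 hS
  obtain ⟨b, hb0, hb⟩ := exists_between (lt_min hT (lt_add_of_pos_right t₀ hε))
  replace hx := hx.mono (hb.le.trans (min_le_left _ _))
  have hSb : ∀ t ∈ Icc t₀ b, AnalyticAt ℝ S t := fun t ht => hεS t (by
    rw [Real.ball_eq_Ioo]
    exact ⟨by linarith [ht.1], ht.2.trans_lt (hb.trans_le (min_le_right _ _))⟩)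
  have hder := hx.hasDerivWithinAt_Icc hf.continuous hb0
  have hxs := contDiffOn_of_hasDerivWithinAt_autonomous hf hb0 hder
  have hSs : ContDiffOn ℝ ∞ S (Icc t₀ b) := fun t ht => (hSb t ht).contDiffAt.contDiffWithinAt
  have ht₀ : t₀ ∈ Icc t₀ b := left_mem_Icc.2 hb0.le
  have hU := uniqueDiffOn_Icc hb0
  have hzero : ∀ k, iteratedDerivWithin k (fun t => x t - S t) (Icc t₀ b) t₀ = 0 := fun k => by
    have h1 := iteratedDerivWithin_sub (n := k) ht₀ hU
      ((hxs t₀ ht₀).of_le (by exact_mod_cast le_top))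
      ((hSs t₀ ht₀).of_le (by exact_mod_cast le_top))
    refine h1.trans ?_
    rw [iteratedDerivWithin_eq_flowDerivative hf hb0 hder k t₀ ht₀, hx.initial,
      iteratedDerivWithin_eq_iteratedDeriv hU (hSb t₀ ht₀).contDiffAt ht₀, hjet, sub_self]
  refine ⟨isBigO_pow_of_iteratedDerivWithin_eq_zero hb0 (hxs.sub hSs) hzero n, ?_⟩
  -- On the shortened interval `f(x) - S'` is the derivative of `x - S`; its derivatives at `t₀` are
  -- those of `x - S` shifted by one, hence zero.
  have hderiv : EqOn (fun t => f (x t) - deriv S t)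
      (derivWithin (fun t => x t - S t) (Icc t₀ b)) (Icc t₀ b) := fun t ht =>
    (((hder t ht).sub (hSb t ht).differentiableAt.hasDerivAt.hasDerivWithinAt).derivWithin
      (hU t ht)).symm
  have h2 := isBigO_pow_of_iteratedDerivWithin_eq_zero hb0
    ((hxs.sub hSs).derivWithin hU (m := ∞) (by norm_cast))
    (fun k => by rw [← iteratedDerivWithin_succ']; exact hzero (k + 1)) n
  refine h2.congr' ?_ .rfl
  filter_upwards [Icc_mem_nhdsGT hb0] with t ht using (hderiv ht).symm

/-- A solution which is analytic coincides with an analytic function that has the same derivatives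
at the initial time. -/
theorem eqOn_of_analyticOn [CompleteSpace E] (hf : ContDiff ℝ ∞ f) (hT : t₀ < T)
    (hx : IsSolution f t₀ T x₀ x) (hxa : AnalyticOn ℝ x (Icc t₀ T)) {S : ℝ → E} {r : ℝ}
    (hr : 0 < r) (hS : AnalyticOnNhd ℝ S (Ioo (t₀ - r) (t₀ + r)))
    (hjet : ∀ n, iteratedDeriv n S t₀ = flowDerivative f n x₀) {t : ℝ} (ht : t ∈ Icc t₀ T)
    (htr : t < t₀ + r) : x t = S t := by
  have ht₀ : t₀ ∈ Icc t₀ T := left_mem_Icc.2 hT.le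
  have ht₀r : Ioo (t₀ - r) (t₀ + r) ∈ 𝓝 t₀ := Ioo_mem_nhds (by linarith) (by linarith)
  rcases ht.1.eq_or_lt with rfl | htt
  · simpa [flowDerivative, hx.initial] using (hjet 0).symm
  -- At the endpoint `x` is analytic only within the interval, so it is replaced by a two-sided
  -- analytic extension `g`.
  obtain ⟨g, hxg, hg⟩ := analyticWithinAt_iff_exists_analyticAt.1 (hxa t₀ ht₀)
  rw [insert_eq_of_mem ht₀] at hxg
  have hxg' : x =ᶠ[𝓝[>] t₀] g :=
    hxg.filter_mono (nhdsWithin_le_of_mem (Icc_mem_nhdsGT hT))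
  have hgS := (hg.sub (hS t₀ (mem_of_mem_nhds ht₀r))).eventually_eq_zero_of_isBigO_pow fun n =>
    (hx.isBigO_pow_sub hf hT (Filter.mem_of_superset ht₀r fun s hs => hS s hs) hjet n).1.congr'
      (by filter_upwards [hxg'] with s hs; simp [hs]) .rfl
  have hxS : ∀ᶠ s in 𝓝[>] t₀, x s = S s := by
    filter_upwards [hxg', hgS.filter_mono nhdsWithin_le_nhds] with s h1 h2
    rw [h1, ← sub_eq_zero]
    exact h2
  obtain ⟨b, hb, hbS⟩ := mem_nhdsGT_iff_exists_Ioo_subset.1 hxS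
  obtain ⟨s, hs0, hs⟩ := exists_between (lt_min (mem_Ioi.1 hb) htt)
  -- The identity theorem is applied on the open interval; continuity then reaches the endpoint `t`.
  have hIoo : EqOn x S (Ioo t₀ t) := by
    refine AnalyticOnNhd.eqOn_of_preconnected_of_eventuallyEq (z₀ := s) ?_
      (hS.mono fun s hs => ⟨by linarith [hs.1], hs.2.trans htr⟩) isPreconnected_Ioo
      ⟨hs0, hs.trans_le (min_le_right _ _)⟩ ?_
    · exact isOpen_Ioo.analyticOn_iff_analyticOnNhd.1
        (hxa.mono fun s hs => ⟨hs.1.le, hs.2.le.trans ht.2⟩)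
    · filter_upwards [Ioo_mem_nhds hs0 (hs.trans_le (min_le_left _ _))] with s hs using hbS hs
  have hcS : ContinuousOn S (Icc t₀ t) :=
    hS.continuousOn.mono fun s hs => ⟨by linarith [hs.1], hs.2.trans_lt htr⟩
  exact hIoo.of_subset_closure (hx.continuousOn.mono (Icc_subset_Icc_right ht.2)) hcS
    Ioo_subset_Icc_self (closure_Ioo htt.ne).ge (right_mem_Icc.2 htt.le)

end IsSolution

/-- Picard–Lindelöf for an autonomous equation, forward in time. -/
theorem exists_isSolution [CompleteSpace E] (hf : ContDiff ℝ 1 f) (t₀ : ℝ) (x₀ : E) :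
    ∃ T, t₀ < T ∧ ∃ x, IsSolution f t₀ T x₀ x := by
  obtain ⟨x, hx0, ε, hε, hx⟩ :=
    hf.contDiffAt.exists_forall_mem_closedBall_exists_eq_forall_mem_Ioo_hasDerivAt₀ (x₀ := x₀) t₀
  have hsub : Icc t₀ (t₀ + ε / 2) ⊆ Ioo (t₀ - ε) (t₀ + ε) := fun t ht =>
    ⟨by linarith [ht.1], by linarith [ht.2]⟩
  exact ⟨t₀ + ε / 2, by linarith, x, fun t ht => (hx t (hsub ht)).continuousAt.continuousWithinAt,
    hx0, fun t ht => (hx t (hsub (Ioc_subset_Icc_self ht))).hasDerivWithinAt⟩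

/-- An analytic function whose derivatives at the initial time are those prescribed by an
analytic equation is a solution. -/
theorem hasDerivAt_of_iteratedDeriv_eq_flowDerivative [CompleteSpace E] (hf : ContDiff ℝ ∞ f)
    (hfa : AnalyticOnNhd ℝ f univ) {S : ℝ → E} {r : ℝ}
    (hr : 0 < r) (hS : AnalyticOnNhd ℝ S (Ioo (t₀ - r) (t₀ + r)))
    (hjet : ∀ n, iteratedDeriv n S t₀ = flowDerivative f n x₀) {t : ℝ}
    (ht : t ∈ Ioo (t₀ - r) (t₀ + r)) : HasDerivAt S (f (S t)) t := by
  -- The local solution `y` serves only to compare `S'` and `f(S)` near `t₀`: both agree with `f(y)`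
  -- to infinite order.
  obtain ⟨T, hT, y, hy⟩ := exists_isSolution (hf.of_le (by simp)) t₀ x₀
  have hmem : t₀ ∈ Ioo (t₀ - r) (t₀ + r) := ⟨by linarith, by linarith⟩
  have ht₀r : Ioo (t₀ - r) (t₀ + r) ∈ 𝓝 t₀ := isOpen_Ioo.mem_nhds hmem
  have hfS : AnalyticOnNhd ℝ (fun t => f (S t)) (Ioo (t₀ - r) (t₀ + r)) :=
    hfa.comp hS fun _ _ => mem_univ _
  have hS0 : S t₀ = x₀ := by simpa [flowDerivative] using hjet 0
  obtain ⟨K, s, hs, hK⟩ := (hf.of_le (by simp : (1 : WithTop ℕ∞) ≤ ∞)).contDiffAt (x := x₀)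
    |>.exists_lipschitzOnWith
  have hflat : ∀ n : ℕ, (fun t => deriv S t - f (S t)) =O[𝓝[>] t₀] fun t => (t - t₀) ^ n := by
    intro n
    obtain ⟨h1, h2⟩ :=
      hy.isBigO_pow_sub hf hT (Filter.mem_of_superset ht₀r fun s hs => hS s hs) hjet n
    have hyt : ∀ᶠ t in 𝓝[>] t₀, y t ∈ s :=
      ((hy.continuousOn t₀ (left_mem_Icc.2 hT.le)).mono_of_mem_nhdsWithin
        (Icc_mem_nhdsGT hT)).tendsto.eventually (by rwa [hy.initial])
    have hSt : ∀ᶠ t in 𝓝[>] t₀, S t ∈ s :=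
      ((hS t₀ hmem).continuousAt.tendsto.mono_left nhdsWithin_le_nhds).eventually
        (by rwa [hS0])
    have h3 : (fun t => f (y t) - f (S t)) =O[𝓝[>] t₀] fun t => y t - S t := by
      refine .of_bound K ?_
      filter_upwards [hyt, hSt] with t ht1 ht2 using hK.norm_sub_le ht1 ht2
    exact ((h3.trans h1).sub h2).congr_left fun t => by abel
  have h0 := ((hS.deriv t₀ hmem).sub (hfS t₀ hmem)).eventually_eq_zero_of_isBigO_pow hflat
  have h1 : deriv S t = f (S t) :=
    hS.deriv.eqOn_of_preconnected_of_eventuallyEq hfS isPreconnected_Ioo hmem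
      (h0.mono fun t ht => sub_eq_zero.1 ht) ht
  exact h1 ▸ (hS t ht).differentiableAt.hasDerivAt

end Solution

end Butcher

/-! ### The expectation as the sum of the Taylor series. -/

theorem mainTheorem1 {d : ℕ}
    (f : EuclideanSpace ℝ (Fin d) → EuclideanSpace ℝ (Fin d)) (hf : ContDiff ℝ ∞ f)
    (t₀ : ℝ) (x₀ : EuclideanSpace ℝ (Fin d))
    (C : ℝ) (hC : 0 < C) (hbound : ∀ m : ℕ, ‖iteratedFDeriv ℝ m f x₀‖ ≤ C)
    (p : PMF ℕ) (hp : ∀ n, 0 < p n)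
    {Ω : Type*} [MeasurableSpace Ω] (P : Measure Ω) [IsProbabilityMeasure P]
    (𝒯 : Ω → Butcher.AnyLabelledTree)
    (h𝒯 : HasLaw 𝒯 (Butcher.randomTree p).toMeasure P) :
    -- the expectation is finite
    (∀ t ∈ Set.Ico t₀ (t₀ + 1 / C),
      Integrable (fun s => Butcher.treeFunctional f hf p t₀ x₀ t (𝒯 s)) P) ∧
    -- a real-analytic solution equals the expectation
    (∀ (T : ℝ) (x : ℝ → EuclideanSpace ℝ (Fin d)), t₀ < T →
      Butcher.IsSolution f t₀ T x₀ x → AnalyticOn ℝ x (Set.Icc t₀ T) →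
      ∀ t ∈ Set.Icc t₀ T, t < t₀ + 1 / C →
        x t = ∫ s, Butcher.treeFunctional f hf p t₀ x₀ t (𝒯 s) ∂P) ∧
    -- if `f` is real-analytic, a solution exists up to `t₀ + 1 / C`, and every solution
    -- equals the expectation
    (AnalyticOnNhd ℝ f Set.univ →
      (∃ x : ℝ → EuclideanSpace ℝ (Fin d),
        ∀ T, t₀ < T → T < t₀ + 1 / C → Butcher.IsSolution f t₀ T x₀ x) ∧
      ∀ (T : ℝ) (x : ℝ → EuclideanSpace ℝ (Fin d)), t₀ < T →
        Butcher.IsSolution f t₀ T x₀ x →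
        ∀ t ∈ Set.Icc t₀ T, t < t₀ + 1 / C →
          x t = ∫ s, Butcher.treeFunctional f hf p t₀ x₀ t (𝒯 s) ∂P) := by

  have hI : ∀ t ∈ Set.Ico t₀ (t₀ + 1 / C),
      Integrable (fun s => Butcher.treeFunctional f hf p t₀ x₀ t (𝒯 s)) P := fun t ht =>
    (h𝒯.map_eq ▸ Butcher.integrable_treeFunctional hf hC hbound hp ht).comp_aemeasurable
      h𝒯.aemeasurable
  have ha := Butcher.norm_flowDerivative_le hf hbound
  set S : ℝ → EuclideanSpace ℝ (Fin d) := fun t =>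
    ∑' n : ℕ, (t - t₀) ^ n • ((n.factorial : ℝ)⁻¹ • Butcher.flowDerivative f n x₀) with hSdef
  have hr : 0 < 1 / C := by positivity
  have hS : AnalyticOnNhd ℝ S (Set.Ioo (t₀ - 1 / C) (t₀ + 1 / C)) :=
    Butcher.analyticOnNhd_tsum_pow_smul hC ha t₀
  have hjet : ∀ n, iteratedDeriv n S t₀ = Butcher.flowDerivative f n x₀ := fun n => by
    rw [hSdef, Butcher.iteratedDeriv_tsum_pow_smul hC ha t₀ n, smul_smul,
      mul_inv_cancel₀ (by positivity), one_smul]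
  have hint : ∀ t, t₀ ≤ t → t < t₀ + 1 / C →
      ∫ s, Butcher.treeFunctional f hf p t₀ x₀ t (𝒯 s) ∂P = S t := fun t ht htr =>
    (h𝒯.integral_comp (.of_discrete)).trans
      (Butcher.integral_treeFunctional hf hC hbound hp ⟨ht, htr⟩)
  refine ⟨hI, fun T x hT hx hxa t ht htr => ?_, fun hfa => ?_⟩
  · rw [hint t ht.1 htr]
    exact hx.eqOn_of_analyticOn hf hT hxa hr hS hjet ht htr
  · have hSsol : ∀ T, T < t₀ + 1 / C → Butcher.IsSolution f t₀ T x₀ S := fun T hT => by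
      have hd : ∀ t ∈ Set.Icc t₀ T, HasDerivAt S (f (S t)) t := fun t ht =>
        Butcher.hasDerivAt_of_iteratedDeriv_eq_flowDerivative hf hfa hr hS hjet
          ⟨by linarith [ht.1], ht.2.trans_lt hT⟩
      exact ⟨fun t ht => (hd t ht).continuousAt.continuousWithinAt,
        by simpa [Butcher.flowDerivative] using hjet 0,
        fun t ht => (hd t (Set.Ioc_subset_Icc_self ht)).hasDerivWithinAt⟩
    refine ⟨⟨S, fun T _ hT => hSsol T hT⟩, fun T x hT hx t ht htr => ?_⟩
    rw [hint t ht.1 htr]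
    -- Uniqueness needs an interval of positive length, so `t = t₀` is separate.
    rcases ht.1.eq_or_lt with rfl | htt
    · exact hx.initial.trans (hSsol t₀ htr).initial.symm
    · exact (hx.mono ht.2).eqOn (hf.of_le (by simp)) htt (hSsol t htr)
        (Set.right_mem_Icc.2 htt.le)
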